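/- Fix disjoint countably infinite sets of concept names $A$, role names $r$ and individual names $a$. Roles $R$ are role names $r$ and inverse roles $r^-$; put $(r^-)^-=r$. Concepts are given by $$C,D ::= \top \mid A \mid \neg C \mid C\sqcap D \mid C\sqcup D \mid \forall R.C \mid \exists R.C \mid \{a\} \mid (\le 1\ R),$$ with $C\to D := \neg C\sqcup D$ and $C\leftrightarrow D := (C\to D)\sqcap(D\to C)$. An ontology is a finite set of concept inclusions $C\sqsubseteq D$, transitivity declarations $\mathsf{trans}(R)$ and role inclusions $R\sqsubseteq R'$. Interpretations have a non-empty domain and interpret concept names as subsets, role names as binary relations and individual names as elements; $r^-$ is the converse of $r$, $\{a\}$ is the singleton of $a$, $(\le 1\ R)$ is the set of elements with at most one $R$-successor, and the other constructors and statements have their usual meaning. $\mathcal O\models C\sqsubseteq D$ means that every model of $\mathcal O$ satisfies $C\sqsubseteq D$. The description logic $\mathcal{ALC}$ has only role names as roles, only the constructors $\top,A,\neg,\sqcap,\sqcup,\forall,\exists$, and only concept inclusions. The extensions add: $\mathcal S$ transitivity declarations, $\mathcal I$ inverse roles (wherever a role may occur), $\mathcal F$ the concepts $(\le 1\ R)$,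 $\mathcal O$ nominals $\{a\}$, $\mathcal H$ role inclusions. As usual, $(\le 1\ R)$ may be used, in an ontology $\mathcal O$ or in a concept considered together with $\mathcal O$, only if $R$ is simple with respect to $\mathcal O$, that is, if $\mathcal O$ contains neither $\mathsf{trans}(R')$ nor $\mathsf{trans}(R'^-)$ for any $R'$ (including $R'=R$) that is a subrole of $R$ according to the reflexive transitive closure of the role inclusions in $\mathcal O$ and their inverses. A signature is a finite set of concept, role and individual names; $\mathrm{sig}(X)$ is the set of names occurring in $X$. Let $\mathcal L$ be one of these logics, $\mathcal O$ an $\mathcal L$ ontology, $C,C_0$ $\mathcal L$ concepts and $\Sigma$ a signature. * $C_0$ is explicitly $\mathcal L(\Sigma)$-definable under $\mathcal O$ and $C$ if there is an $\mathcal L$ concept $D$ with $\mathrm{sig}(D)\subseteq\Sigma$ and $\mathcal O\models C\sqsubseteq (C_0\leftrightarrow D)$. * $C_0$ is implicitly $\Sigma$-definable under $\mathcal O$ and $C$ if for all models $\mathcal I,\mathcal J$ of $\mathcal O$ with the same domain and the same interpretation of the names in $\Sigma$, and all $d\in C^{\mathcal I}\cap C^{\mathcal J}$, we have $d\in C_0^{\mathcal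 I}$ iff $d\in C_0^{\mathcal J}$. * $\mathcal L$ has the projective Beth definability property if for all $\mathcal L$ ontologies $\mathcal O$, $\mathcal L$ concepts $C,C_0$ and signatures $\Sigma\subseteq\mathrm{sig}(C)\cup\mathrm{sig}(\mathcal O)$: if $C_0$ is implicitly $\Sigma$-definable under $\mathcal O$ and $C$, then $C_0$ is explicitly $\mathcal L(\Sigma)$-definable under $\mathcal O$ and $C$. **Statement.** For every subset $X\subseteq\{\mathcal S,\mathcal I,\mathcal F\}$ (including the empty one), the extension of $\mathcal{ALC}$ by $X$ has the projective Beth definability property, whereas neither the extension of $\mathcal{ALC}$ by $X\cup\{\mathcal O\}$ nor the extension of $\mathcal{ALC}$ by $X\cup\{\mathcal H\}$ has it. -/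

import Mathlib

namespace DescLogic

/-- The additional features: transitive roles (`S`), inverse roles (`I`), local functionality
restrictions (`F`), nominals (`O`) and role hierarchies (`H`). -/
inductive Feature : Type
  | S | I | F | O | H

/-- The extension of `ALC` by a set of features; `ALC` itself is the empty set. -/
abbrev Logic : Type := Set Feature

/-- Symbols: three disjoint countably infinite sets of concept, role and individual names. -/
inductive Symb : Type
  | conceptName (A : ℕ)
  | roleName (r : ℕ)
  | individual (a : ℕ)

/-- A signature is a finite set of symbols. -/
abbrev Signature : Type := Finset Symb

/-- Roles: role names `r` and inverse roles `r⁻`. -/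
inductive Role : Type
  | name (r : ℕ)
  | inverse (r : ℕ)

namespace Role

/-- The inverse of a role, with `(r⁻)⁻ = r`. -/
def inv : Role → Role
  | name r => inverse r
  | inverse r => name r

/-- The symbols occurring in a role. -/
def sig : Role → Set Symb
  | name r => {Symb.roleName r}
  | inverse r => {Symb.roleName r}

/-- Inverse roles are available only in logics with the feature `I`. -/
def InLogic (L : Logic) : Role → Prop
  | name _ => True
  | inverse _ => Feature.I ∈ L

end Role

/-- Concepts with all constructors; `nominal a` is `{a}` and `atMostOne R` is `(≤ 1 R)`. -/
inductive Concept : Type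
  | top
  | name (A : ℕ)
  | neg (C : Concept)
  | inter (C D : Concept)
  | union (C D : Concept)
  | all (R : Role) (C : Concept)
  | ex (R : Role) (C : Concept)
  | nominal (a : ℕ)
  | atMostOne (R : Role)

namespace Concept

/-- `C → D` abbreviates `¬C ⊔ D`. -/
def imp (C D : Concept) : Concept := union (neg C) D

/-- `C ↔ D` abbreviates `(C → D) ⊓ (D → C)`. -/
def biimp (C D : Concept) : Concept := inter (imp C D) (imp D C)

/-- The symbols occurring in a concept. -/
def sig : Concept → Set Symb
  | top => ∅
  | name A => {Symb.conceptName A}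
  | neg C => C.sig
  | inter C D => C.sig ∪ D.sig
  | union C D => C.sig ∪ D.sig
  | all R C => R.sig ∪ C.sig
  | ex R C => R.sig ∪ C.sig
  | nominal a => {Symb.individual a}
  | atMostOne R => R.sig

/-- The roles `R` for which `(≤ 1 R)` occurs in a concept. -/
def funcRoles : Concept → Set Role
  | top => ∅
  | name _ => ∅
  | neg C => C.funcRoles
  | inter C D => C.funcRoles ∪ D.funcRoles
  | union C D => C.funcRoles ∪ D.funcRoles
  | all _ C => C.funcRoles
  | ex _ C => C.funcRoles
  | nominal _ => ∅
  | atMostOne R => {R}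

/-- Only constructors of the logic `L` are used. -/
def InLogic (L : Logic) : Concept → Prop
  | top => True
  | name _ => True
  | neg C => C.InLogic L
  | inter C D => C.InLogic L ∧ D.InLogic L
  | union C D => C.InLogic L ∧ D.InLogic L
  | all R C => R.InLogic L ∧ C.InLogic L
  | ex R C => R.InLogic L ∧ C.InLogic L
  | nominal _ => Feature.O ∈ L
  | atMostOne R => Feature.F ∈ L ∧ R.InLogic L

end Concept

/-- The statements that an ontology may contain: concept inclusions `C ⊑ D`, transitivity
declarations `trans(R)` and role inclusions `R ⊑ R'`. -/
inductive Ax : Type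
  | conceptIncl (C D : Concept)
  | trans (R : Role)
  | roleIncl (R R' : Role)

namespace Ax

def sig : Ax → Set Symb
  | conceptIncl C D => C.sig ∪ D.sig
  | trans R => R.sig
  | roleIncl R R' => R.sig ∪ R'.sig

def funcRoles : Ax → Set Role
  | conceptIncl C D => C.funcRoles ∪ D.funcRoles
  | trans _ => ∅
  | roleIncl _ _ => ∅

def InLogic (L : Logic) : Ax → Prop
  | conceptIncl C D => C.InLogic L ∧ D.InLogic L
  | trans R => Feature.S ∈ L ∧ R.InLogic L
  | roleIncl R R' => Feature.H ∈ L ∧ R.InLogic L ∧ R'.InLogic L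

end Ax

/-- An ontology is a finite set of such statements. -/
abbrev Ontology : Type := Finset Ax

namespace Ontology

def sig (T : Ontology) : Set Symb := {s | ∃ α ∈ T, s ∈ α.sig}

/-- The reflexive transitive closure of the role inclusions of `T` and their inverses. -/
inductive SubRole (T : Ontology) : Role → Role → Prop
  | refl (R : Role) : SubRole T R R
  | step {R R' R'' : Role} : SubRole T R R' → Ax.roleIncl R' R'' ∈ T → SubRole T R R''
  | stepInv {R R' R'' : Role} :
      SubRole T R R'.inv → Ax.roleIncl R' R'' ∈ T → SubRole T R R''.inv

/-- A role is simple if neither it nor any of its subroles (nor their inverses) is declared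
transitive. -/
def Simple (T : Ontology) (R : Role) : Prop :=
  ∀ R', SubRole T R' R → Ax.trans R' ∉ T ∧ Ax.trans R'.inv ∉ T

/-- `T` is an `L` ontology: it uses only the constructors of `L`, and functionality restrictions
only on simple roles (the usual restriction on combining `F` with `S`). -/
def IsOntologyOf (L : Logic) (T : Ontology) : Prop :=
  ∀ α ∈ T, α.InLogic L ∧ ∀ R ∈ α.funcRoles, T.Simple R

/-- `C` is an `L` concept that may be used together with `T`: it uses only the constructors of `L`,
and functionality restrictions only on roles that are simple with respect to `T`. -/
def IsConceptOf (L : Logic) (T : Ontology) (C : Concept) : Prop :=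
  C.InLogic L ∧ ∀ R ∈ C.funcRoles, T.Simple R

end Ontology

/-- Interpretations with domain `Δ`; the domain is non-empty because individual names denote
elements of it. -/
structure Interp (Δ : Type) where
  concept : ℕ → Set Δ
  role : ℕ → Set (Δ × Δ)
  individual : ℕ → Δ

namespace Interp

variable {Δ : Type}

/-- The extension of a role. -/
def roleExt (M : Interp Δ) : Role → Set (Δ × Δ)
  | Role.name r => M.role r
  | Role.inverse r => {p | (p.2, p.1) ∈ M.role r}

/-- The extension of a concept. -/
def ext (M : Interp Δ) : Concept → Set Δ
  | Concept.top => Set.univ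
  | Concept.name A => M.concept A
  | Concept.neg C => (M.ext C)ᶜ
  | Concept.inter C D => M.ext C ∩ M.ext D
  | Concept.union C D => M.ext C ∪ M.ext D
  | Concept.all R C => {d | ∀ e, (d, e) ∈ M.roleExt R → e ∈ M.ext C}
  | Concept.ex R C => {d | ∃ e, (d, e) ∈ M.roleExt R ∧ e ∈ M.ext C}
  | Concept.nominal a => {M.individual a}
  | Concept.atMostOne R =>
      {d | ∀ e e', (d, e) ∈ M.roleExt R → (d, e') ∈ M.roleExt R → e = e'}

/-- Satisfaction of a statement. -/
def Sat (M : Interp Δ) : Ax → Prop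
  | Ax.conceptIncl C D => M.ext C ⊆ M.ext D
  | Ax.trans R => ∀ d e f, (d, e) ∈ M.roleExt R → (e, f) ∈ M.roleExt R → (d, f) ∈ M.roleExt R
  | Ax.roleIncl R R' => M.roleExt R ⊆ M.roleExt R'

/-- `M` is a model of the ontology `T`. -/
def IsModel (M : Interp Δ) (T : Ontology) : Prop := ∀ α ∈ T, M.Sat α

/-- Two interpretations with the same domain have the same reduct to the signature `Sg`. -/
def SameReduct (Sg : Signature) (M N : Interp Δ) : Prop :=
  (∀ A, Symb.conceptName A ∈ Sg → M.concept A = N.concept A) ∧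
  (∀ r, Symb.roleName r ∈ Sg → M.role r = N.role r) ∧
  (∀ a, Symb.individual a ∈ Sg → M.individual a = N.individual a)

end Interp

/-- `T ⊨ C ⊑ D`. -/
def Entails (T : Ontology) (C D : Concept) : Prop :=
  ∀ (Δ : Type) (M : Interp Δ), M.IsModel T → M.ext C ⊆ M.ext D

/-- `C₀` is explicitly `L(Sg)`-definable under `T` and `C`. -/
def ExplicitlyDefinable (L : Logic) (T : Ontology) (C C₀ : Concept) (Sg : Signature) : Prop :=
  ∃ D : Concept, T.IsConceptOf L D ∧ D.sig ⊆ (Sg : Set Symb) ∧ Entails T C (C₀.biimp D)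

/-- `C₀` is implicitly `Sg`-definable under `T` and `C`: models of `T` with the same `Sg`-reduct
agree on `C₀` at every element that satisfies the context concept `C` in both of them. -/
def ImplicitlyDefinable (T : Ontology) (C C₀ : Concept) (Sg : Signature) : Prop :=
  ∀ (Δ : Type) (M N : Interp Δ), M.IsModel T → N.IsModel T → M.SameReduct Sg N →
    ∀ d : Δ, d ∈ M.ext C → d ∈ N.ext C → (d ∈ M.ext C₀ ↔ d ∈ N.ext C₀)

/-- The projective Beth definability property of the logic `L`. -/
def PBDP (L : Logic) : Prop :=
  ∀ (T : Ontology) (C C₀ : Concept) (Sg : Signature),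
    T.IsOntologyOf L → T.IsConceptOf L C → T.IsConceptOf L C₀ →
    (Sg : Set Symb) ⊆ C.sig ∪ T.sig →
    ImplicitlyDefinable T C C₀ Sg → ExplicitlyDefinable L T C C₀ Sg

end DescLogic

/-! Positive part. Suppose that no concept over `Sg` defines `C₀` under `T` and `C`. Boolean
combinations of `Sg`-concepts then fail to separate the pointed models of `C ⊓ C₀` from those of `C
⊓ ¬C₀`, so for every finite set of `Sg`-concepts some pair of such models agrees on it
(`exists_agree`). Disjoint unions put both points of a pair into one model. An ultraproduct of these
unions over `ℕ` is a model with two points that satisfy the same `Sg`-concepts, of which only one is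
in `C₀`; by saturation (`ultraproduct_saturated`), satisfying the same `Sg`-concepts is a
bisimulation on it (`exists_equiv_successor`).

Such a model `M` is amalgamated with itself: the elements are pairs of equivalent points, in many
copies. Names in `Sg` are read symmetrically in both components, the others through the first
component only. Exchanging the components gives a second model with the same `Sg`-reduct, and the
pair formed by the two points contradicts implicit definability.

The delicate point is functionality of roles outside `Sg`: lifting an edge to all equivalent second
components would create many successors. Instead, all fibres of the first projection are identified
with one set (`exists_trivialization`), and an edge lifts only within one level of that
identification, hence uniquely. Roles in and outside `Sg` are thus lifted in different ways, so role
inclusions need not survive; nominals fail because a point has many copies.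

Negative part. Two explicit ontologies make a concept implicitly definable from role names alone.
Each has a model where that concept is neither empty nor full, while all elements have two
successors along every available role and its inverse, which makes every concept over the signature
trivial, whatever features are present. -/

namespace DescLogic

open Filter

/-! ### Failure with nominals or role inclusions -/

/-- If `Sg` has only role names and every element has two successors along every role over `Sg`,
then every concept over `Sg` is trivial. -/
theorem Interp.ext_eq_empty_or_univ {Δ : Type} (M : Interp Δ) (Sg : Set Symb)
    (hA : ∀ A, Symb.conceptName A ∉ Sg) (ha : ∀ a, Symb.individual a ∉ Sg)
    (hR : ∀ R : Role, R.sig ⊆ Sg → ∀ d, ∃ e e', (d, e) ∈ M.roleExt R ∧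
      (d, e') ∈ M.roleExt R ∧ e ≠ e')
    (D : Concept) (hD : D.sig ⊆ Sg) : M.ext D = ∅ ∨ M.ext D = Set.univ := by
  induction D with
  | top => exact Or.inr rfl
  | name A => exact absurd (hD rfl) (hA A)
  | neg C ih =>
    rcases ih hD with h | h
    · right; simp [ext, h]
    · left; simp [ext, h]
  | inter C D ihC ihD =>
    simp only [Concept.sig, Set.union_subset_iff] at hD
    rcases ihC hD.1 with h | h <;> rcases ihD hD.2 with h' | h' <;> simp [ext, h, h']
  | union C D ihC ihD =>
    simp only [Concept.sig, Set.union_subset_iff] at hD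
    rcases ihC hD.1 with h | h <;> rcases ihD hD.2 with h' | h' <;> simp [ext, h, h']
  | all R C ih =>
    simp only [Concept.sig, Set.union_subset_iff] at hD
    rcases ih hD.2 with h | h
    · left
      ext d
      obtain ⟨e, -, he, -⟩ := hR R hD.1 d
      simp only [ext, h, Set.mem_ofPred_eq, Set.mem_empty_iff_false, iff_false]
      exact fun hd => hd e he
    · right; simp [ext, h]
  | ex R C ih =>
    simp only [Concept.sig, Set.union_subset_iff] at hD
    rcases ih hD.2 with h | h
    · left; simp [ext, h]
    · right
      ext d
      obtain ⟨e, -, he, -⟩ := hR R hD.1 d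
      simpa [ext, h] using ⟨e, he⟩
  | nominal a => exact absurd (hD rfl) (ha a)
  | atMostOne R =>
    left
    ext d
    obtain ⟨e, e', he, he', hne⟩ := hR R hD d
    simp only [ext, Set.mem_ofPred_eq, Set.mem_empty_iff_false, iff_false]
    exact fun hd => hne (hd e e' he he')

/-- A concept that is non-trivial in such a model has no explicit definition. -/
theorem not_explicitlyDefinable_top {Δ : Type} (M : Interp Δ) {L : Logic} {T : Ontology}
    {C₀ : Concept} {Sg : Signature} (hM : M.IsModel T)
    (hA : ∀ A, Symb.conceptName A ∉ Sg) (ha : ∀ a, Symb.individual a ∉ Sg)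
    (hR : ∀ R : Role, R.sig ⊆ (Sg : Set Symb) → ∀ d, ∃ e e', (d, e) ∈ M.roleExt R ∧
      (d, e') ∈ M.roleExt R ∧ e ≠ e')
    {d e : Δ} (hd : d ∈ M.ext C₀) (he : e ∉ M.ext C₀) :
    ¬ ExplicitlyDefinable L T Concept.top C₀ Sg := by
  rintro ⟨D, -, hD, hent⟩
  have h1 := hent Δ M hM (Set.mem_univ d)
  have h2 := hent Δ M hM (Set.mem_univ e)
  simp only [Concept.biimp, Concept.imp, Interp.ext, Set.mem_inter_iff, Set.mem_union,
    Set.mem_compl_iff] at h1 h2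
  rcases M.ext_eq_empty_or_univ Sg (by simpa using hA) (by simpa using ha) hR D hD with h | h <;>
    simp [h] at h1 h2 <;> tauto

/-- The denotation of the nominal is the only `r`-reflexive point. -/
def reflexivePoint : List Ax :=
  [ .conceptIncl (.nominal 0) (.ex (.name 0) (.nominal 0)),
    .conceptIncl (.inter (.name 0) (.neg (.nominal 0)))
      (.all (.name 0) (.union (.nominal 0) (.neg (.name 0)))),
    .conceptIncl (.inter (.neg (.name 0)) (.neg (.nominal 0)))
      (.all (.name 0) (.union (.nominal 0) (.name 0))) ]

open Classical in
theorem not_PBDP_of_nominals (L : Logic) (hL : Feature.O ∈ L) : ¬ PBDP L := by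
  intro h
  have hT : ∀ α, α ∈ reflexivePoint.toFinset ↔ α ∈ reflexivePoint := by simp
  -- Outside the nominal, an edge that does not end in the nominal changes membership in `A`, so it
  -- cannot be a loop.
  have hmodel : ∀ {Δ : Type} (M : Interp Δ), M.IsModel reflexivePoint.toFinset →
      ∀ d, d ∈ M.ext (.nominal 0) ↔ (d, d) ∈ M.role 0 := by
    intro Δ M hM d
    replace hM : ∀ α ∈ reflexivePoint, M.Sat α := fun α hα => hM α ((hT α).2 hα)
    simp only [reflexivePoint, List.forall_mem_cons, Interp.Sat] at hM
    obtain ⟨h1, h2, h3, -⟩ := hM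
    constructor
    · intro hd
      obtain ⟨e, he, he'⟩ := h1 hd
      rw [Set.mem_singleton_iff.1 (show e ∈ {M.individual 0} from he'),
        ← Set.mem_singleton_iff.1 (show d ∈ {M.individual 0} from hd)] at he
      exact he
    · intro hd
      by_contra hna
      by_cases hA : d ∈ M.concept 0
      · rcases h2 ⟨hA, hna⟩ d hd with h | h
        · exact hna h
        · exact h hA
      · rcases h3 ⟨hA, hna⟩ d hd with h | h
        · exact hna h
        · exact hA h
  have key : ¬ ExplicitlyDefinable L reflexivePoint.toFinset .top (.nominal 0)
      {Symb.roleName 0} := by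
    -- All edges except the loops at `1` and `2`. Off the nominal `0`, the only edges that avoid `0`
    -- join `1` and `2`, which `A = {1}` tells apart.
    let M : Interp (Fin 3) :=
      { concept := fun _ => {1}
        role := fun _ => {p | p.1 = 0 ∨ p.1 ≠ p.2}
        individual := fun _ => 0 }
    refine not_explicitlyDefinable_top M ?_ (by simp) (by simp) ?_ (d := 0) (e := 1) rfl ?_
    · suffices ∀ α ∈ reflexivePoint, M.Sat α from fun α hα => this α ((hT α).1 hα)
      simp only [reflexivePoint, List.forall_mem_cons, Interp.Sat]
      refine ⟨?_, ?_, ?_, by simp⟩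
      · rintro d hd
        exact ⟨0, Or.inl hd, rfl⟩
      · rintro d ⟨hA, hd⟩ e he
        simp only [M, Interp.ext, Interp.roleExt, Set.mem_singleton_iff, Set.mem_compl_iff,
          Set.mem_ofPred_eq, Set.mem_union] at *
        omega
      · rintro d ⟨hA, hd⟩ e he
        simp only [M, Interp.ext, Interp.roleExt, Set.mem_singleton_iff, Set.mem_compl_iff,
          Set.mem_ofPred_eq, Set.mem_union] at *
        omega
    · rintro (r | r) - d <;>
        simp only [M, Interp.roleExt, Set.mem_ofPred_eq] <;> revert d <;> decide
    · simp [M, Interp.ext]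
  refine key (h _ _ _ _ ?_ ?_ ?_ ?_ ?_)
  · intro α hα
    rw [hT] at hα
    revert α
    simp [reflexivePoint, Ax.InLogic, Concept.InLogic, Role.InLogic, hL, Ax.funcRoles,
      Concept.funcRoles]
  · simp [Ontology.IsConceptOf, Concept.InLogic, Concept.funcRoles]
  · simp [Ontology.IsConceptOf, Concept.InLogic, Concept.funcRoles, hL]
  · simp [Ontology.sig, reflexivePoint, Ax.sig, Concept.sig, Role.sig]
  · intro Δ M N hM hN hMN d _ _
    rw [hmodel M hM, hmodel N hN, hMN.2.1 0 (by simp)]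

/-- The elements with an `r`-successor are those with a common successor of the two superroles. -/
def commonSuccessor : List Ax :=
  [ .roleIncl (.name 0) (.name 1),
    .roleIncl (.name 0) (.name 2),
    .conceptIncl (.inter (.neg (.ex (.name 0) .top)) (.ex (.name 1) (.name 0)))
      (.all (.name 2) (.neg (.name 0))),
    .conceptIncl (.inter (.neg (.ex (.name 0) .top)) (.ex (.name 1) (.neg (.name 0))))
      (.all (.name 2) (.name 0)) ]

open Classical in
theorem not_PBDP_of_roleHierarchies (L : Logic) (hL : Feature.H ∈ L) : ¬ PBDP L := by
  intro h
  have hT : ∀ α, α ∈ commonSuccessor.toFinset ↔ α ∈ commonSuccessor := by simp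
  -- Without a successor along role `0`, the successors along roles `1` and `2` lie on opposite
  -- sides of `A`, so none is common.
  have hmodel : ∀ {Δ : Type} (M : Interp Δ), M.IsModel commonSuccessor.toFinset →
      ∀ d, d ∈ M.ext (.ex (.name 0) .top) ↔ ∃ e, (d, e) ∈ M.role 1 ∧ (d, e) ∈ M.role 2 := by
    intro Δ M hM d
    replace hM : ∀ α ∈ commonSuccessor, M.Sat α := fun α hα => hM α ((hT α).2 hα)
    simp only [commonSuccessor, List.forall_mem_cons, Interp.Sat] at hM
    obtain ⟨h1, h2, h3, h4, -⟩ := hM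
    constructor
    · rintro ⟨e, he, -⟩
      exact ⟨e, h1 he, h2 he⟩
    · rintro ⟨e, he1, he2⟩
      by_contra hd
      by_cases hA : e ∈ M.concept 0
      · exact h3 ⟨hd, e, he1, hA⟩ e he2 hA
      · exact hA (h4 ⟨hd, e, he1, hA⟩ e he2)
  have key : ¬ ExplicitlyDefinable L commonSuccessor.toFinset .top (.ex (.name 0) .top)
      {Symb.roleName 1, Symb.roleName 2} := by
    -- The first coordinate marks the points with a successor along role `0`, which see everything;
    -- the second is `A`. From the other points, role `1` leads to `A` and role `2` to its
    -- complement, each with two elements.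
    let M : Interp (Bool × Bool) :=
      { concept := fun _ => {x | x.2 = true}
        role := fun r => {p | p.1.1 = true ∨ r = 1 ∧ p.2.2 = true ∨ r = 2 ∧ p.2.2 = false}
        individual := fun _ => (true, true) }
    refine not_explicitlyDefinable_top M ?_ (by simp) (by simp) ?_
      (d := (true, true)) (e := (false, true)) ⟨(true, true), Or.inl rfl, trivial⟩ ?_
    · suffices ∀ α ∈ commonSuccessor, M.Sat α from fun α hα => this α ((hT α).1 hα)
      simp only [commonSuccessor, List.forall_mem_cons, Interp.Sat]
      refine ⟨?_, ?_, ?_, ?_, by simp⟩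
      · rintro p (hp | ⟨hp, -⟩ | ⟨hp, -⟩)
        · exact Or.inl hp
        all_goals simp at hp
      · rintro p (hp | ⟨hp, -⟩ | ⟨hp, -⟩)
        · exact Or.inl hp
        all_goals simp at hp
      · rintro d ⟨hd, -⟩ e he
        simp [M, Interp.ext, Interp.roleExt] at *
        simpa [hd] using he
      · rintro d ⟨hd, e, he, heA⟩
        simp [M, Interp.ext, Interp.roleExt] at *
        simp [hd, heA] at he
    · rintro (r | r) hr d <;>
      · have hr : r = 1 ∨ r = 2 := by simpa [Role.sig] using hr
        simp only [M, Interp.roleExt, Set.mem_ofPred_eq]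
        rcases hr with rfl | rfl <;> revert d <;> decide
    · simp [M, Interp.ext, Interp.roleExt]
  refine key (h _ _ _ _ ?_ ?_ ?_ ?_ ?_)
  · intro α hα
    rw [hT] at hα
    revert α
    simp [commonSuccessor, Ax.InLogic, Concept.InLogic, Role.InLogic, hL, Ax.funcRoles,
      Concept.funcRoles]
  · simp [Ontology.IsConceptOf, Concept.InLogic, Concept.funcRoles]
  · simp [Ontology.IsConceptOf, Concept.InLogic, Concept.funcRoles, Role.InLogic]
  · simp [Ontology.sig, commonSuccessor, Ax.sig, Concept.sig, Role.sig, Set.insert_subset_iff]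
  · intro Δ M N hM hN hMN d _ _
    rw [hmodel M hM, hmodel N hN, hMN.2.1 1 (by simp), hMN.2.1 2 (by simp)]

/-! ### Maps that preserve concepts -/

/-- A functional bisimulation for all concepts of `L` usable with `T`, except nominals. -/
structure IsCover (L : Logic) (T : Ontology) {Δ Δ' : Type} (M : Interp Δ) (N : Interp Δ')
    (p : Δ → Δ') : Prop where
  concept : ∀ A d, d ∈ M.concept A ↔ p d ∈ N.concept A
  forth : ∀ R d e, R.InLogic L → (d, e) ∈ M.roleExt R → (p d, p e) ∈ N.roleExt R
  back : ∀ R d e', R.InLogic L → (p d, e') ∈ N.roleExt R → ∃ e, p e = e' ∧ (d, e) ∈ M.roleExt R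
  func : ∀ R d, Feature.F ∈ L → R.InLogic L → T.Simple R →
    p d ∈ N.ext (.atMostOne R) → d ∈ M.ext (.atMostOne R)

namespace Ontology

variable {L : Logic} {T : Ontology}

theorem isConceptOf_top : T.IsConceptOf L .top := ⟨trivial, fun _ h => h.elim⟩

theorem IsConceptOf.inter {C D : Concept} (hC : T.IsConceptOf L C) (hD : T.IsConceptOf L D) :
    T.IsConceptOf L (.inter C D) :=
  ⟨⟨hC.1, hD.1⟩, fun R hR => hR.elim (hC.2 R) (hD.2 R)⟩

end Ontology

namespace IsCover

variable {L : Logic} {T : Ontology} {Δ Δ' : Type} {M : Interp Δ} {N : Interp Δ'} {p : Δ → Δ'}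

/-- For `atMostOne`, passing from `M` to `N` follows by lifting successors with `back`. The converse
fails for general bisimulations, since distinct successors may have one image; this is what the
field `func` excludes. -/
theorem mem_ext_iff (h : IsCover L T M N p) (hO : Feature.O ∉ L) {C : Concept}
    (hC : T.IsConceptOf L C) (d : Δ) : d ∈ M.ext C ↔ p d ∈ N.ext C := by
  obtain ⟨hC, hF⟩ := hC
  induction C generalizing d with
  | top => exact iff_of_true trivial trivial
  | name A => exact h.concept A d
  | neg C ih => exact not_congr (ih d hC hF)
  | inter C D ihC ihD =>
    exact and_congr (ihC d hC.1 (fun R hR => hF R (Or.inl hR)))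
      (ihD d hC.2 (fun R hR => hF R (Or.inr hR)))
  | union C D ihC ihD =>
    exact or_congr (ihC d hC.1 (fun R hR => hF R (Or.inl hR)))
      (ihD d hC.2 (fun R hR => hF R (Or.inr hR)))
  | all R C ih =>
    constructor
    · intro hd e' he'
      obtain ⟨e, rfl, he⟩ := h.back R d e' hC.1 he'
      exact (ih e hC.2 hF).1 (hd e he)
    · exact fun hd e he => (ih e hC.2 hF).2 (hd _ (h.forth R d e hC.1 he))
  | ex R C ih =>
    constructor
    · rintro ⟨e, he, heC⟩
      exact ⟨p e, h.forth R d e hC.1 he, (ih e hC.2 hF).1 heC⟩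
    · rintro ⟨e', he', heC⟩
      obtain ⟨e, rfl, he⟩ := h.back R d e' hC.1 he'
      exact ⟨e, he, (ih e hC.2 hF).2 heC⟩
  | nominal a => exact absurd hC hO
  | atMostOne R =>
    refine ⟨fun hd e e' he he' => ?_, h.func R d hC.1 hC.2 (hF R rfl)⟩
    obtain ⟨c, rfl, hc⟩ := h.back R d e hC.2 he
    obtain ⟨c', rfl, hc'⟩ := h.back R d e' hC.2 he'
    rw [hd c c' hc hc']

/-- Covers reflect models, up to transitivity declarations. -/
theorem isModel (h : IsCover L T M N p) (hO : Feature.O ∉ L) (hH : Feature.H ∉ L)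
    (hT : T.IsOntologyOf L) (hN : N.IsModel T)
    (htrans : ∀ R, Ax.trans R ∈ T → M.Sat (.trans R)) : M.IsModel T := by
  intro α hα
  obtain ⟨hL, hF⟩ := hT α hα
  have hsat := hN α hα
  cases α with
  | conceptIncl C D =>
    intro d hd
    refine (h.mem_ext_iff hO ⟨hL.2, fun R hR => hF R (Or.inr hR)⟩ d).2 (hsat ?_)
    exact (h.mem_ext_iff hO ⟨hL.1, fun R hR => hF R (Or.inl hR)⟩ d).1 hd
  | trans R => exact htrans R hα
  | roleIncl R R' => exact absurd hL.1 hH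

end IsCover

/-! ### Disjoint unions -/

/-- The disjoint union of two interpretations. -/
def Interp.sum {Δ Δ' : Type} (M : Interp Δ) (N : Interp Δ') : Interp (Δ ⊕ Δ') where
  concept A := {x | Sum.elim (· ∈ M.concept A) (· ∈ N.concept A) x}
  role r := {p | Sum.LiftRel (fun a b => (a, b) ∈ M.role r) (fun a b => (a, b) ∈ N.role r) p.1 p.2}
  individual a := Sum.inl (M.individual a)

section Sum

variable {Δ Δ' : Type} (M : Interp Δ) (N : Interp Δ')

theorem Interp.mem_roleExt_sum (R : Role) (x y : Δ ⊕ Δ') : (x, y) ∈ (M.sum N).roleExt R ↔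
    Sum.LiftRel (fun a b => (a, b) ∈ M.roleExt R) (fun a b => (a, b) ∈ N.roleExt R) x y := by
  cases R with
  | name r => exact Iff.rfl
  | inverse r => cases x <;> cases y <;> simp [roleExt, sum]

theorem isCover_inl (L : Logic) (T : Ontology) : IsCover L T M (M.sum N) Sum.inl where
  concept A d := Iff.rfl
  forth R d e _ h := (M.mem_roleExt_sum N R _ _).2 (.inl h)
  back R d e' _ h := by
    rw [M.mem_roleExt_sum N] at h
    cases h with
    | inl h => exact ⟨_, rfl, h⟩
  func R d _ _ _ h e e' he he' := Sum.inl_injective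
    (h _ _ ((M.mem_roleExt_sum N R _ _).2 (.inl he)) ((M.mem_roleExt_sum N R _ _).2 (.inl he')))

theorem isCover_inr (L : Logic) (T : Ontology) : IsCover L T N (M.sum N) Sum.inr where
  concept A d := Iff.rfl
  forth R d e _ h := (M.mem_roleExt_sum N R _ _).2 (.inr h)
  back R d e' _ h := by
    rw [M.mem_roleExt_sum N] at h
    cases h with
    | inr h => exact ⟨_, rfl, h⟩
  func R d _ _ _ h e e' he he' := Sum.inr_injective
    (h _ _ ((M.mem_roleExt_sum N R _ _).2 (.inr he)) ((M.mem_roleExt_sum N R _ _).2 (.inr he')))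

variable {M N}

theorem Interp.IsModel.sum {L : Logic} {T : Ontology} (hO : Feature.O ∉ L) (hH : Feature.H ∉ L)
    (hT : T.IsOntologyOf L) (hM : M.IsModel T) (hN : N.IsModel T) : (M.sum N).IsModel T := by
  intro α hα
  obtain ⟨hL, hF⟩ := hT α hα
  have hM := hM α hα
  have hN := hN α hα
  cases α with
  | conceptIncl C D =>
    have hC : T.IsConceptOf L C := ⟨hL.1, fun R hR => hF R (Or.inl hR)⟩
    have hD : T.IsConceptOf L D := ⟨hL.2, fun R hR => hF R (Or.inr hR)⟩
    rintro (d | d) hd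
    · exact ((isCover_inl M N L T).mem_ext_iff hO hD d).1
        (hM (((isCover_inl M N L T).mem_ext_iff hO hC d).2 hd))
    · exact ((isCover_inr M N L T).mem_ext_iff hO hD d).1
        (hN (((isCover_inr M N L T).mem_ext_iff hO hC d).2 hd))
  | trans R =>
    intro d e f hde hef
    rw [Interp.mem_roleExt_sum] at hde hef ⊢
    cases hde with
    | inl hde => cases hef with
      | inl hef => exact .inl (hM _ _ _ hde hef)
    | inr hde => cases hef with
      | inr hef => exact .inr (hN _ _ _ hde hef)
  | roleIncl R R' => exact absurd hL.1 hH

end Sum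

/-! ### Countable ultraproducts -/

section Ultraproduct

variable {Δ : ℕ → Type} (M : ∀ i, Interp (Δ i))

/-- The ultraproduct of a sequence of interpretations. -/
noncomputable def ultraproduct : Interp (Filter.Product (hyperfilter ℕ : Filter ℕ) Δ) where
  concept A := {x | ∀ᶠ i in hyperfilter ℕ, x.out i ∈ (M i).concept A}
  role r := {p | ∀ᶠ i in hyperfilter ℕ, (p.1.out i, p.2.out i) ∈ (M i).role r}
  individual a := Quotient.mk _ fun i => (M i).individual a

/-- The ultraproduct is defined through chosen representatives; this allows them to be replaced by
any others. -/
theorem out_mk_eventuallyEq (f : ∀ i, Δ i) :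
    ∀ᶠ i in hyperfilter ℕ,
      (Quotient.mk _ f : Filter.Product (hyperfilter ℕ : Filter ℕ) Δ).out i = f i :=
  Quotient.exact (Quotient.out_eq (Quotient.mk (productSetoid (hyperfilter ℕ : Filter ℕ) Δ) f))

theorem eq_of_out_eventuallyEq {x y : Filter.Product (hyperfilter ℕ : Filter ℕ) Δ}
    (h : ∀ᶠ i in hyperfilter ℕ, x.out i = y.out i) : x = y :=
  Quotient.out_equiv_out.1 h

theorem mem_roleExt_ultraproduct (R : Role) (x y : Filter.Product (hyperfilter ℕ : Filter ℕ) Δ) :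
    (x, y) ∈ (ultraproduct M).roleExt R ↔
      ∀ᶠ i in hyperfilter ℕ, (x.out i, y.out i) ∈ (M i).roleExt R := by
  cases R <;> rfl

theorem mem_roleExt_ultraproduct_mk {R : Role}
    {x : Filter.Product (hyperfilter ℕ : Filter ℕ) Δ} {f : ∀ i, Δ i}
    (h : ∀ᶠ i in hyperfilter ℕ, (x.out i, f i) ∈ (M i).roleExt R) :
    (x, Quotient.mk _ f) ∈ (ultraproduct M).roleExt R := by
  refine (mem_roleExt_ultraproduct M R x _).2 ?_
  filter_upwards [h, out_mk_eventuallyEq f] with i hi hf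
  rwa [hf]

/-- The theorem of Łoś for concepts. -/
theorem mem_ext_ultraproduct (C : Concept) (x : Filter.Product (hyperfilter ℕ : Filter ℕ) Δ) :
    x ∈ (ultraproduct M).ext C ↔ ∀ᶠ i in hyperfilter ℕ, x.out i ∈ (M i).ext C := by
  induction C generalizing x with
  | top => simp [Interp.ext]
  | name A => exact Iff.rfl
  | neg C ih => exact (not_congr (ih x)).trans Ultrafilter.eventually_not.symm
  | inter C D ihC ihD => exact (and_congr (ihC x) (ihD x)).trans eventually_and.symm
  | union C D ihC ihD => exact (or_congr (ihC x) (ihD x)).trans Ultrafilter.eventually_or.symm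
  | all R C ih =>
    constructor
    · intro hx
      by_contra hcon
      rw [← Ultrafilter.eventually_not] at hcon
      have : ∀ i, ∃ e : Δ i, x.out i ∉ (M i).ext (.all R C) →
          (x.out i, e) ∈ (M i).roleExt R ∧ e ∉ (M i).ext C := by
        intro i
        by_cases h : x.out i ∈ (M i).ext (.all R C)
        · exact ⟨x.out i, fun h' => absurd h h'⟩
        · simp only [Interp.ext, Set.mem_ofPred_eq, not_forall] at h
          obtain ⟨e, he, he'⟩ := h
          exact ⟨e, fun _ => ⟨he, he'⟩⟩
      choose f hf using this
      have h1 := (ih _).1 (hx _ (mem_roleExt_ultraproduct_mk M (hcon.mono fun i hi => (hf i hi).1)))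
      obtain ⟨i, hi, hi', hi''⟩ := (h1.and (hcon.and (out_mk_eventuallyEq f))).exists
      rw [hi''] at hi
      exact (hf i hi').2 hi
    · intro hx y hy
      rw [mem_roleExt_ultraproduct] at hy
      rw [ih]
      filter_upwards [hx, hy] with i hi hi'
      exact hi _ hi'
  | ex R C ih =>
    constructor
    · rintro ⟨y, hy, hyC⟩
      rw [mem_roleExt_ultraproduct] at hy
      rw [ih] at hyC
      filter_upwards [hy, hyC] with i hi hi'
      exact ⟨_, hi, hi'⟩
    · intro hx
      have : ∀ i, ∃ e : Δ i, x.out i ∈ (M i).ext (.ex R C) →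
          (x.out i, e) ∈ (M i).roleExt R ∧ e ∈ (M i).ext C := by
        intro i
        by_cases h : x.out i ∈ (M i).ext (.ex R C)
        · exact ⟨h.choose, fun _ => h.choose_spec⟩
        · exact ⟨x.out i, fun h' => absurd h' h⟩
      choose f hf using this
      refine ⟨_, mem_roleExt_ultraproduct_mk M (f := f) (hx.mono fun i hi => (hf i hi).1), ?_⟩
      refine (ih _).2 ?_
      filter_upwards [hx, out_mk_eventuallyEq f] with i hi hi'
      rw [hi']
      exact (hf i hi).2
  | nominal a =>
    constructor
    · intro hx
      rw [show x = _ from hx]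
      exact out_mk_eventuallyEq _
    · intro hx
      refine Set.mem_singleton_iff.2 (eq_of_out_eventuallyEq ?_)
      filter_upwards [hx, out_mk_eventuallyEq fun i => (M i).individual a] with i hi hi'
      exact (Set.mem_singleton_iff.1 hi).trans hi'.symm
  | atMostOne R =>
    constructor
    · intro hx
      by_contra hcon
      rw [← Ultrafilter.eventually_not] at hcon
      have : ∀ i, ∃ e e' : Δ i, x.out i ∉ (M i).ext (.atMostOne R) →
          (x.out i, e) ∈ (M i).roleExt R ∧ (x.out i, e') ∈ (M i).roleExt R ∧ e ≠ e' := by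
        intro i
        by_cases h : x.out i ∈ (M i).ext (.atMostOne R)
        · exact ⟨x.out i, x.out i, fun h' => absurd h h'⟩
        · simp only [Interp.ext, Set.mem_ofPred_eq, not_forall] at h
          obtain ⟨e, e', he, he', hne⟩ := h
          exact ⟨e, e', fun _ => ⟨he, he', hne⟩⟩
      choose f g hfg using this
      have h1 := Quotient.exact (hx _ _
        (mem_roleExt_ultraproduct_mk M (f := f) (hcon.mono fun i hi => (hfg i hi).1))
        (mem_roleExt_ultraproduct_mk M (f := g) (hcon.mono fun i hi => (hfg i hi).2.1)))
      obtain ⟨i, hi, hi'⟩ := (Filter.Eventually.and h1 hcon).exists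
      exact (hfg i hi').2.2 hi
    · intro hx y z hy hz
      rw [mem_roleExt_ultraproduct] at hy hz
      apply eq_of_out_eventuallyEq
      filter_upwards [hx, hy, hz] with i hi hi' hi''
      exact hi _ _ hi' hi''

theorem mk_mem_ext_ultraproduct {C : Concept} {f : ∀ i, Δ i}
    (h : ∀ᶠ i in hyperfilter ℕ, f i ∈ (M i).ext C) :
    Quotient.mk _ f ∈ (ultraproduct M).ext C := by
  refine (mem_ext_ultraproduct M C _).2 ?_
  filter_upwards [h, out_mk_eventuallyEq f] with i hi hf
  rwa [hf]

theorem ultraproduct_isModel {T : Ontology} (h : ∀ i, (M i).IsModel T) :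
    (ultraproduct M).IsModel T := by
  intro α hα
  have h := fun i => h i α hα
  cases α with
  | conceptIncl C D =>
    intro x hx
    rw [mem_ext_ultraproduct] at hx ⊢
    exact hx.mono fun i hi => h i hi
  | trans R =>
    intro x y z hxy hyz
    rw [mem_roleExt_ultraproduct] at hxy hyz ⊢
    filter_upwards [hxy, hyz] with i hi hi'
    exact h i _ _ _ hi hi'
  | roleIncl R R' =>
    rintro ⟨x, y⟩ hxy
    rw [mem_roleExt_ultraproduct] at hxy ⊢
    exact hxy.mono fun i hi => h i hi

/-- The conjunction of the first `n` concepts of a sequence. -/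
def Concept.conj (F : ℕ → Concept) : ℕ → Concept
  | 0 => .top
  | n + 1 => .inter (Concept.conj F n) (F n)

theorem Interp.mem_ext_conj {Δ : Type} (M : Interp Δ) (F : ℕ → Concept) (n : ℕ) (d : Δ) :
    d ∈ M.ext (.conj F n) ↔ ∀ k < n, d ∈ M.ext (F k) := by
  induction n with
  | zero => simp [Concept.conj, ext]
  | succ n ih =>
    rw [Nat.forall_lt_succ_right, ← ih]
    exact Iff.rfl

/-- Countable ultraproducts are modally saturated. -/
theorem ultraproduct_saturated {R : Role} {F : ℕ → Concept}
    {x : Filter.Product (hyperfilter ℕ : Filter ℕ) Δ}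
    (h : ∀ n, x ∈ (ultraproduct M).ext (.ex R (.conj F n))) :
    ∃ y, (x, y) ∈ (ultraproduct M).roleExt R ∧ ∀ k, y ∈ (ultraproduct M).ext (F k) := by
  classical
  -- Diagonal choice: at index `i`, take a successor that satisfies the conjunction of the first `n`
  -- concepts, for the largest possible `n ≤ i`. Each `F k` is reached once `i ≥ k + 1` and `P i (k
  -- + 1)`, which holds for almost all `i`.
  let P : ∀ _ : ℕ, ℕ → Prop := fun i n => x.out i ∈ (M i).ext (.ex R (.conj F n))
  have hP : ∀ n, ∀ᶠ i in hyperfilter ℕ, P i n := fun n => (mem_ext_ultraproduct M _ x).1 (h n)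
  have : ∀ i, ∃ e : Δ i, P i (Nat.findGreatest (P i) i) → (x.out i, e) ∈ (M i).roleExt R ∧
      e ∈ (M i).ext (.conj F (Nat.findGreatest (P i) i)) := by
    intro i
    by_cases hi : P i (Nat.findGreatest (P i) i)
    · exact ⟨hi.choose, fun _ => hi.choose_spec⟩
    · exact ⟨x.out i, fun h' => absurd h' hi⟩
  choose f hf using this
  refine ⟨Quotient.mk _ f, mem_roleExt_ultraproduct_mk M ?_, fun k => mk_mem_ext_ultraproduct M ?_⟩
  · filter_upwards [hP 0] with i hi
    exact (hf i (Nat.findGreatest_spec (Nat.zero_le i) hi)).1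
  · filter_upwards [hP (k + 1), Nat.hyperfilter_le_atTop (eventually_ge_atTop (k + 1))] with i hi hk
    exact ((M i).mem_ext_conj F _ _).1 (hf i (Nat.findGreatest_spec hk hi)).2 k
      (Nat.le_findGreatest hk hi)

end Ultraproduct

/-! ### Equivalence with respect to a signature -/

/-- The `L` concepts over `Sg` that may be used together with `T`. -/
def conceptsOver (L : Logic) (T : Ontology) (Sg : Signature) : Set Concept :=
  {D | T.IsConceptOf L D ∧ D.sig ⊆ (Sg : Set Symb)}

/-- `a` and `b` satisfy the same concepts of a set. -/
def Interp.equiv {Δ : Type} (M : Interp Δ) (S : Set Concept) (a b : Δ) : Prop :=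
  ∀ D ∈ S, a ∈ M.ext D ↔ b ∈ M.ext D

theorem Interp.equiv_equivalence {Δ : Type} (M : Interp Δ) (S : Set Concept) :
    Equivalence (M.equiv S) :=
  ⟨fun _ _ _ => Iff.rfl, fun h D hD => (h D hD).symm, fun h h' D hD => (h D hD).trans (h' D hD)⟩

/-- A numbering of the roles. -/
def Role.code : Role → ℕ
  | name r => 2 * r
  | inverse r => 2 * r + 1

theorem Role.code_injective : Function.Injective Role.code := by
  rintro (r | r) (s | s) h <;> simp only [code] at h
  all_goals first | omega | (congr 1; omega)

/-- A numbering of the concepts. -/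
def Concept.code : Concept → ℕ
  | top => Nat.pair 0 0
  | name A => Nat.pair 1 A
  | neg C => Nat.pair 2 C.code
  | inter C D => Nat.pair 3 (Nat.pair C.code D.code)
  | union C D => Nat.pair 4 (Nat.pair C.code D.code)
  | all R C => Nat.pair 5 (Nat.pair R.code C.code)
  | ex R C => Nat.pair 6 (Nat.pair R.code C.code)
  | nominal a => Nat.pair 7 a
  | atMostOne R => Nat.pair 8 R.code

theorem Concept.code_injective : Function.Injective Concept.code := by
  intro C
  induction C with
  | top => rintro (_ | _) h <;> simp_all [code, Nat.pair_eq_pair]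
  | name A => rintro (_ | _) h <;> simp_all [code, Nat.pair_eq_pair]
  | neg C ih =>
    rintro (_ | _) h <;> simp only [code, Nat.pair_eq_pair] at h <;> try omega
    rw [ih h.2]
  | inter C D ihC ihD =>
    rintro (_ | _) h <;> simp only [code, Nat.pair_eq_pair] at h <;> try omega
    rw [ihC h.2.1, ihD h.2.2]
  | union C D ihC ihD =>
    rintro (_ | _) h <;> simp only [code, Nat.pair_eq_pair] at h <;> try omega
    rw [ihC h.2.1, ihD h.2.2]
  | all R C ih =>
    rintro (_ | _) h <;> simp only [code, Nat.pair_eq_pair] at h <;> try omega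
    rw [Role.code_injective h.2.1, ih h.2.2]
  | ex R C ih =>
    rintro (_ | _) h <;> simp only [code, Nat.pair_eq_pair] at h <;> try omega
    rw [Role.code_injective h.2.1, ih h.2.2]
  | nominal a => rintro (_ | _) h <;> simp_all [code, Nat.pair_eq_pair]
  | atMostOne R =>
    rintro (_ | _) h <;> simp only [code, Nat.pair_eq_pair] at h <;> try omega
    rw [Role.code_injective h.2]

/-- Saturation of ultraproducts over `ℕ` handles sequences of concepts; by countability, a sequence
exhausts a full type. -/
theorem exists_enumeration (L : Logic) (T : Ontology) (Sg : Signature) :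
    ∃ F : ℕ → Concept, conceptsOver L T Sg = Set.range F := by
  have : Countable Concept := Concept.code_injective.countable
  exact (Set.to_countable _).exists_eq_range
    ⟨.top, Ontology.isConceptOf_top, Set.empty_subset _⟩

/-- Equivalence of elements of a countable ultraproduct is a bisimulation. -/
theorem exists_equiv_successor {L : Logic} {T : Ontology} {Sg : Signature} {Δ : ℕ → Type}
    (M : ∀ i, Interp (Δ i)) {a b a' : Filter.Product (hyperfilter ℕ : Filter ℕ) Δ}
    (hab : (ultraproduct M).equiv (conceptsOver L T Sg) a b) {R : Role} (hR : R.InLogic L)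
    (hRS : R.sig ⊆ (Sg : Set Symb)) (ha : (a, a') ∈ (ultraproduct M).roleExt R) :
    ∃ b', (b, b') ∈ (ultraproduct M).roleExt R ∧
      (ultraproduct M).equiv (conceptsOver L T Sg) a' b' := by
  classical
  obtain ⟨F, hF⟩ := exists_enumeration L T Sg
  have hFS : ∀ n, F n ∈ conceptsOver L T Sg := fun n => hF ▸ Set.mem_range_self n
  -- `G` lists the full type of `a'`. The concept `∃R` applied to a finite conjunction of it holds
  -- at `a`, is over `Sg`, and so transfers to `b`, where saturation applies.
  let G : ℕ → Concept := fun n => if a' ∈ (ultraproduct M).ext (F n) then F n else .neg (F n)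
  have hG : ∀ n, G n ∈ conceptsOver L T Sg := by
    intro n
    simp only [G]
    split_ifs
    · exact hFS n
    · exact hFS n
  have haG : ∀ n, a' ∈ (ultraproduct M).ext (G n) := by
    intro n
    simp only [G]
    split_ifs with h
    · exact h
    · exact h
  have hconj : ∀ n, .conj G n ∈ conceptsOver L T Sg := by
    intro n
    induction n with
    | zero => exact ⟨Ontology.isConceptOf_top, Set.empty_subset _⟩
    | succ n ih => exact ⟨ih.1.inter (hG n).1, Set.union_subset ih.2 (hG n).2⟩
  obtain ⟨b', hb', hbG⟩ := ultraproduct_saturated M (R := R) (F := G) (x := b) fun n =>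
    (hab (.ex R (.conj G n)) ⟨⟨⟨hR, (hconj n).1.1⟩, (hconj n).1.2⟩,
      Set.union_subset hRS (hconj n).2⟩).1
      ⟨a', ha, (Interp.mem_ext_conj _ G n a').2 fun k _ => haG k⟩
  refine ⟨b', hb', fun D hD => ?_⟩
  rw [hF] at hD
  obtain ⟨n, rfl⟩ := hD
  have := hbG n
  simp only [G] at this
  split_ifs at this with h
  · exact iff_of_true h this
  · exact iff_of_false h this

/-! ### Separation -/

/-- Two classes of pointed interpretations that no concept of `S` separates contain, for every
finite part of `S`, two pointed interpretations that agree on it. -/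
theorem exists_agree {S : Set Concept} (htop : Concept.top ∈ S) (hneg : ∀ C ∈ S, C.neg ∈ S)
    (hinter : ∀ C ∈ S, ∀ D ∈ S, C.inter D ∈ S) (hunion : ∀ C ∈ S, ∀ D ∈ S, C.union D ∈ S)
    (l : List Concept) (hl : ∀ D ∈ l, D ∈ S) (P Q : ∀ Δ : Type, Interp Δ → Δ → Prop)
    (h : ¬ ∃ D ∈ S, (∀ Δ M d, P Δ M d → d ∈ M.ext D) ∧ (∀ Δ M d, Q Δ M d → d ∉ M.ext D)) :
    ∃ (Δ Δ' : Type) (M : Interp Δ) (N : Interp Δ') (d : Δ) (e : Δ'), P Δ M d ∧ Q Δ' N e ∧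
      ∀ D ∈ l, d ∈ M.ext D ↔ e ∈ N.ext D := by
  induction l generalizing P Q with
  | nil =>
    by_contra hcon
    by_cases hP : ∃ Δ M d, P Δ M d
    · obtain ⟨Δ, M, d, hd⟩ := hP
      refine h ⟨.top, htop, fun _ _ _ _ => trivial, fun Δ' N e he _ => hcon ?_⟩
      exact ⟨Δ, Δ', M, N, d, e, hd, he, by simp⟩
    · refine h ⟨.neg .top, hneg _ htop, fun Δ M d hd => (hP ⟨Δ, M, d, hd⟩).elim,
        fun _ _ _ _ h => h trivial⟩
  | cons C l ih =>
    by_contra hcon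
    have hC := hl C List.mem_cons_self
    have hl' : ∀ D ∈ l, D ∈ S := fun D hD => hl D (List.mem_cons_of_mem C hD)
    -- If no pair agrees on `C :: l`, the induction hypothesis separates the two classes both inside
    -- `C`, by some `D`, and outside `C`, by some `E`. Then `(C ⊓ D) ⊔ (¬C ⊓ E)` separates them
    -- outright.
    have h1 := mt (ih hl' (fun Δ M d => P Δ M d ∧ d ∈ M.ext C)
      (fun Δ M d => Q Δ M d ∧ d ∈ M.ext C)) (by
        rintro ⟨Δ, Δ', M, N, d, e, ⟨hd, hdC⟩, ⟨he, heC⟩, hag⟩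
        exact hcon ⟨Δ, Δ', M, N, d, e, hd, he,
          List.forall_mem_cons.2 ⟨iff_of_true hdC heC, hag⟩⟩)
    have h2 := mt (ih hl' (fun Δ M d => P Δ M d ∧ d ∉ M.ext C)
      (fun Δ M d => Q Δ M d ∧ d ∉ M.ext C)) (by
        rintro ⟨Δ, Δ', M, N, d, e, ⟨hd, hdC⟩, ⟨he, heC⟩, hag⟩
        exact hcon ⟨Δ, Δ', M, N, d, e, hd, he,
          List.forall_mem_cons.2 ⟨iff_of_false hdC heC, hag⟩⟩)
    obtain ⟨D, hD, hPD, hQD⟩ := not_not.1 h1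
    obtain ⟨E, hE, hPE, hQE⟩ := not_not.1 h2
    refine h ⟨.union (.inter C D) (.inter C.neg E), hunion _ (hinter _ hC _ hD) _
      (hinter _ (hneg _ hC) _ hE), fun Δ M d hd => ?_, fun Δ M d hd => ?_⟩
    · by_cases hdC : d ∈ M.ext C
      · exact Or.inl ⟨hdC, hPD Δ M d ⟨hd, hdC⟩⟩
      · exact Or.inr ⟨hdC, hPE Δ M d ⟨hd, hdC⟩⟩
    · rintro (⟨hdC, hdD⟩ | ⟨hdC, hdE⟩)
      · exact hQD Δ M d ⟨hd, hdC⟩ hdD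
      · exact hQE Δ M d ⟨hd, hdC⟩ hdE

/-! ### Amalgamation -/

section Amalgam

variable {Δ : Type} (M : Interp Δ) (S : Set Concept)

/-- Pairs of equivalent elements, each in as many copies as `ℕ × Δ` has elements. -/
abbrev AmalgamDomain : Type := {p : Δ × Δ // M.equiv S p.1 p.2} × (ℕ × Δ)

/-- The fibres of the first projection can be identified with each other. -/
theorem exists_trivialization : ∃ g : AmalgamDomain M S → ℕ × Δ,
    Function.Bijective fun w => (w.1.1.1, g w) := by
  have : ∀ a : Δ, Nonempty ({b // M.equiv S a b} × (ℕ × Δ) ≃ ℕ × Δ) := by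
    intro a
    have : Nonempty Δ := ⟨a⟩
    have : Nonempty {b // M.equiv S a b} := ⟨a, (M.equiv_equivalence S).refl a⟩
    -- The factor `ℕ × Δ` is infinite and at least as large as any equivalence class, so it absorbs
    -- the class.
    refine Cardinal.eq.1 ?_
    rw [Cardinal.mk_prod, Cardinal.lift_id, Cardinal.lift_id]
    refine Cardinal.mul_eq_right (Cardinal.aleph0_le_mk _) ?_ (Cardinal.mk_ne_zero _)
    exact Cardinal.mk_le_of_injective (f := fun b => (0, b.1)) fun b c h =>
      Subtype.ext (Prod.ext_iff.1 h).2
  have β := fun a => (this a).some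
  refine ⟨fun w => β w.1.1.1 (⟨w.1.1.2, w.1.2⟩, w.2), ?_, ?_⟩
  · rintro ⟨⟨⟨a, b⟩, h⟩, k⟩ ⟨⟨⟨a', b'⟩, h'⟩, k'⟩ heq
    obtain ⟨rfl, heq⟩ := Prod.ext_iff.1 heq
    have := (β a).injective heq
    simp only [Prod.mk.injEq, Subtype.mk.injEq] at this
    obtain ⟨rfl, rfl⟩ := this
    rfl
  · rintro ⟨a, k⟩
    refine ⟨(⟨(a, ((β a).symm k).1.1), ((β a).symm k).1.2⟩, ((β a).symm k).2), ?_⟩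
    simp

/-- The interpretation of the names outside the signature is pulled back along the first
projection. -/
noncomputable def amalgam (Sg : Signature) (i : Δ) : Interp (AmalgamDomain M S) where
  concept A := {w | w.1.1.1 ∈ M.concept A}
  role r := {p | (p.1.1.1.1, p.2.1.1.1) ∈ M.role r ∧
    (Symb.roleName r ∈ Sg → (p.1.1.1.2, p.2.1.1.2) ∈ M.role r ∧ p.1.2 = p.2.2) ∧
    (Symb.roleName r ∉ Sg →
      (exists_trivialization M S).choose p.1 = (exists_trivialization M S).choose p.2)}
  individual _ := (⟨(i, i), (M.equiv_equivalence S).refl i⟩, (0, i))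

theorem mem_roleExt_amalgam_of_mem {Sg : Signature} {R : Role} (hR : R.sig ⊆ (Sg : Set Symb))
    (i : Δ) (w w' : AmalgamDomain M S) : (w, w') ∈ (amalgam M S Sg i).roleExt R ↔
      (w.1.1.1, w'.1.1.1) ∈ M.roleExt R ∧ (w.1.1.2, w'.1.1.2) ∈ M.roleExt R ∧ w.2 = w'.2 := by
  cases R with
  | name r =>
    have hr : Symb.roleName r ∈ Sg := by simpa [Role.sig] using hR
    simp [Interp.roleExt, amalgam, hr]
  | inverse r =>
    have hr : Symb.roleName r ∈ Sg := by simpa [Role.sig] using hR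
    simp [Interp.roleExt, amalgam, hr, eq_comm]

theorem mem_roleExt_amalgam_of_notMem {Sg : Signature} {R : Role} (hR : ¬ R.sig ⊆ (Sg : Set Symb))
    (i : Δ) (w w' : AmalgamDomain M S) : (w, w') ∈ (amalgam M S Sg i).roleExt R ↔
      (w.1.1.1, w'.1.1.1) ∈ M.roleExt R ∧
      (exists_trivialization M S).choose w = (exists_trivialization M S).choose w' := by
  cases R with
  | name r =>
    have hr : Symb.roleName r ∉ Sg := by simpa [Role.sig] using hR
    simp [Interp.roleExt, amalgam, hr]
  | inverse r =>
    have hr : Symb.roleName r ∉ Sg := by simpa [Role.sig] using hR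
    simp [Interp.roleExt, amalgam, hr, eq_comm]

variable {L : Logic} {T : Ontology} {Sg : Signature}

/-- Edges over `Sg` lift because equivalence is a bisimulation, the other edges because the
trivialization is surjective on each fibre. -/
theorem isCover_amalgam (i : Δ)
    (hbis : ∀ R a b a', R.InLogic L → R.sig ⊆ (Sg : Set Symb) →
      M.equiv (conceptsOver L T Sg) a b → (a, a') ∈ M.roleExt R →
      ∃ b', (b, b') ∈ M.roleExt R ∧ M.equiv (conceptsOver L T Sg) a' b') :
    IsCover L T (amalgam M (conceptsOver L T Sg) Sg i) M (fun w => w.1.1.1) where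
  concept A d := Iff.rfl
  forth R d e _ h := by
    by_cases hRS : R.sig ⊆ (Sg : Set Symb)
    · exact ((mem_roleExt_amalgam_of_mem M _ hRS i d e).1 h).1
    · exact ((mem_roleExt_amalgam_of_notMem M _ hRS i d e).1 h).1
  back R d e' hR h := by
    by_cases hRS : R.sig ⊆ (Sg : Set Symb)
    · obtain ⟨b', hb', heq⟩ := hbis R _ _ _ hR hRS d.1.2 h
      exact ⟨(⟨(e', b'), heq⟩, d.2), rfl,
        (mem_roleExt_amalgam_of_mem M _ hRS i _ _).2 ⟨h, hb', rfl⟩⟩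
    · obtain ⟨e, he⟩ := (exists_trivialization M (conceptsOver L T Sg)).choose_spec.2
        (e', (exists_trivialization M (conceptsOver L T Sg)).choose d)
      obtain ⟨rfl, he⟩ := Prod.ext_iff.1 he
      exact ⟨e, rfl, (mem_roleExt_amalgam_of_notMem M _ hRS i _ _).2 ⟨h, he.symm⟩⟩
  func R d hF hR hs h e e' he he' := by
    by_cases hRS : R.sig ⊆ (Sg : Set Symb)
    -- `(≤ 1 R)` is itself a concept over `Sg`, so the equivalent second component satisfies it too.
    · have h2 : d.1.1.2 ∈ M.ext (.atMostOne R) := by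
        refine (d.1.2 (.atMostOne R) ⟨⟨⟨hF, hR⟩, ?_⟩, hRS⟩).1 h
        rintro R' rfl
        exact hs
      rw [mem_roleExt_amalgam_of_mem M _ hRS] at he he'
      exact Prod.ext (Subtype.ext (Prod.ext (h _ _ he.1 he'.1) (h2 _ _ he.2.1 he'.2.1)))
        (he.2.2.symm.trans he'.2.2)
    · rw [mem_roleExt_amalgam_of_notMem M _ hRS] at he he'
      exact (exists_trivialization M (conceptsOver L T Sg)).choose_spec.1
        (Prod.ext (h _ _ he.1 he'.1) (he.2.symm.trans he'.2))

/-- Covers need not reflect transitivity, but here each condition defining a role is transitive: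
edges in the components and equality of copies or levels. -/
theorem amalgam_isModel (i : Δ) (hO : Feature.O ∉ L) (hH : Feature.H ∉ L)
    (hT : T.IsOntologyOf L) (hM : M.IsModel T)
    (hbis : ∀ R a b a', R.InLogic L → R.sig ⊆ (Sg : Set Symb) →
      M.equiv (conceptsOver L T Sg) a b → (a, a') ∈ M.roleExt R →
      ∃ b', (b, b') ∈ M.roleExt R ∧ M.equiv (conceptsOver L T Sg) a' b') :
    (amalgam M (conceptsOver L T Sg) Sg i).IsModel T := by
  refine (isCover_amalgam M i hbis).isModel hO hH hT hM fun R hR d e f hde hef => ?_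
  have htr : M.Sat (.trans R) := hM _ hR
  by_cases hRS : R.sig ⊆ (Sg : Set Symb)
  · rw [mem_roleExt_amalgam_of_mem M _ hRS] at hde hef ⊢
    exact ⟨htr _ _ _ hde.1 hef.1, htr _ _ _ hde.2.1 hef.2.1, hde.2.2.trans hef.2.2⟩
  · rw [mem_roleExt_amalgam_of_notMem M _ hRS] at hde hef ⊢
    exact ⟨htr _ _ _ hde.1 hef.1, hde.2.trans hef.2⟩

/-- Exchanging the components of a pair. -/
def AmalgamDomain.swap (w : AmalgamDomain M S) : AmalgamDomain M S :=
  (⟨w.1.1.swap, (M.equiv_equivalence S).symm w.1.2⟩, w.2)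

end Amalgam

/-- The pullback of an interpretation along a map of its domain. -/
def Interp.comap {Δ : Type} (M : Interp Δ) (s : Δ → Δ) : Interp Δ where
  concept A := {d | s d ∈ M.concept A}
  role r := {p | (s p.1, s p.2) ∈ M.role r}
  individual a := s (M.individual a)

theorem Interp.mem_roleExt_comap {Δ : Type} (M : Interp Δ) (s : Δ → Δ) (R : Role) (d e : Δ) :
    (d, e) ∈ (M.comap s).roleExt R ↔ (s d, s e) ∈ M.roleExt R := by
  cases R <;> rfl

theorem isCover_comap {Δ : Type} (M : Interp Δ) {s : Δ → Δ} (hs : Function.Involutive s)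
    (L : Logic) (T : Ontology) : IsCover L T (M.comap s) M s where
  concept A d := Iff.rfl
  forth R d e _ h := (M.mem_roleExt_comap s R d e).1 h
  back R d e' _ h := ⟨s e', hs e', (M.mem_roleExt_comap s R d _).2 (by rwa [hs e'])⟩
  func R d _ _ _ h e e' he he' := hs.injective
    (h _ _ ((M.mem_roleExt_comap s R d e).1 he) ((M.mem_roleExt_comap s R d e').1 he'))

/-! ### The projective Beth definability property -/

/-- Equivalent elements of a model on which equivalence is a bisimulation cannot be told apart by
an implicitly definable concept. -/
theorem ImplicitlyDefinable.mem_ext_of_equiv {L : Logic} {T : Ontology} {Sg : Signature}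
    {C C₀ : Concept} (hO : Feature.O ∉ L) (hH : Feature.H ∉ L) (hT : T.IsOntologyOf L)
    (hC : T.IsConceptOf L C) (hC₀ : T.IsConceptOf L C₀)
    (hSg : ∀ a, Symb.individual a ∉ Sg) (himp : ImplicitlyDefinable T C C₀ Sg)
    {Δ : Type} {M : Interp Δ} (hM : M.IsModel T)
    (hbis : ∀ R a b a', R.InLogic L → R.sig ⊆ (Sg : Set Symb) →
      M.equiv (conceptsOver L T Sg) a b → (a, a') ∈ M.roleExt R →
      ∃ b', (b, b') ∈ M.roleExt R ∧ M.equiv (conceptsOver L T Sg) a' b')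
    {d e : Δ} (hde : M.equiv (conceptsOver L T Sg) d e) (hd : d ∈ M.ext C) (he : e ∈ M.ext C)
    (hd₀ : d ∈ M.ext C₀) : e ∈ M.ext C₀ := by
  have hcov := isCover_amalgam M d hbis
  have hmod := amalgam_isModel M d hO hH hT hM hbis
  set A := amalgam M (conceptsOver L T Sg) Sg d
  have hinv : Function.Involutive (AmalgamDomain.swap M (conceptsOver L T Sg)) := fun w => rfl
  have hcov' := isCover_comap A hinv L T
  have hmod' : (A.comap (AmalgamDomain.swap M _)).IsModel T := by
    refine hcov'.isModel hO hH hT hmod fun R hR x y z hxy hyz => ?_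
    rw [Interp.mem_roleExt_comap] at hxy hyz ⊢
    exact hmod _ hR _ _ _ hxy hyz
  -- Equivalent components agree on concept names in `Sg`, and the condition for role names in `Sg`
  -- is symmetric in the components.
  have hred : A.SameReduct Sg (A.comap (AmalgamDomain.swap M _)) := by
    refine ⟨fun B hB => ?_, fun r hr => ?_, fun a ha => absurd ha (hSg a)⟩
    · ext w
      refine w.1.2 (.name B) ⟨⟨trivial, fun _ h => h.elim⟩, ?_⟩
      simpa [Concept.sig] using hB
    · have hrS : (Role.name r).sig ⊆ (Sg : Set Symb) := by simpa [Role.sig] using hr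
      ext ⟨w, w'⟩
      refine (mem_roleExt_amalgam_of_mem M _ hrS d w w').trans (Iff.trans ?_
        (mem_roleExt_amalgam_of_mem M _ hrS d (w.swap M _) (w'.swap M _)).symm)
      exact and_left_comm.trans Iff.rfl
  -- At `w` the amalgam behaves like `M` at `d`, and its exchanged version like `M` at `e`.
  let w : AmalgamDomain M (conceptsOver L T Sg) := (⟨(d, e), hde⟩, (0, d))
  have key := himp _ A _ hmod hmod' hred w ((hcov.mem_ext_iff hO hC w).2 hd)
    ((hcov'.mem_ext_iff hO hC w).2 ((hcov.mem_ext_iff hO hC _).2 he))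
  exact (hcov.mem_ext_iff hO hC₀ _).1 ((hcov'.mem_ext_iff hO hC₀ w).1
    (key.1 ((hcov.mem_ext_iff hO hC₀ w).2 hd₀)))

/-- The amalgam and its exchanged version may interpret individual names differently, so `Sg` must
contain none. Without nominals this follows from `Sg` being part of the signature of `C` and `T`. -/
theorem Concept.InLogic.individual_notMem_sig {L : Logic} (hO : Feature.O ∉ L) {C : Concept}
    (hC : C.InLogic L) (a : ℕ) : Symb.individual a ∉ C.sig := by
  have hR : ∀ R : Role, Symb.individual a ∉ R.sig := by rintro (r | r) h <;> cases h
  induction C with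
  | top => exact fun h => h
  | name A => rintro ⟨⟩
  | neg C ih => exact ih hC
  | inter C D ihC ihD => exact fun h => h.elim (ihC hC.1) (ihD hC.2)
  | union C D ihC ihD => exact fun h => h.elim (ihC hC.1) (ihD hC.2)
  | all R C ih => exact fun h => h.elim (hR R) (ih hC.2)
  | ex R C ih => exact fun h => h.elim (hR R) (ih hC.2)
  | nominal a => exact absurd hC hO
  | atMostOne R => exact hR R

theorem Ontology.IsOntologyOf.individual_notMem_sig {L : Logic} (hO : Feature.O ∉ L)
    {T : Ontology} (hT : T.IsOntologyOf L) (a : ℕ) : Symb.individual a ∉ T.sig := by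
  have hR : ∀ R : Role, Symb.individual a ∉ R.sig := by rintro (r | r) h <;> cases h
  rintro ⟨α, hα, ha⟩
  have hL := (hT α hα).1
  cases α with
  | conceptIncl C D =>
    exact ha.elim (hL.1.individual_notMem_sig hO a) (hL.2.individual_notMem_sig hO a)
  | trans R => exact hR R ha
  | roleIncl R R' => exact ha.elim (hR R) (hR R')

theorem PBDP_of_no_nominals_no_roleHierarchies (L : Logic) (hO : Feature.O ∉ L)
    (hH : Feature.H ∉ L) : PBDP L := by
  intro T C C₀ Sg hT hC hC₀ hSg himp
  have hind : ∀ a, Symb.individual a ∉ Sg := fun a ha =>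
    (hSg ha).elim (hC.1.individual_notMem_sig hO a) (hT.individual_notMem_sig hO a)
  by_contra hexp
  obtain ⟨F, hF⟩ := exists_enumeration L T Sg
  have hFS : ∀ n, F n ∈ conceptsOver L T Sg := fun n => hF ▸ Set.mem_range_self n
  -- A concept that separates the two classes would be an explicit definition; hence the `n`-th pair
  -- agrees on the first `n` concepts over `Sg`.
  have hsep := fun n => exists_agree (S := conceptsOver L T Sg)
    ⟨Ontology.isConceptOf_top, Set.empty_subset _⟩ (fun _ h => h)
    (fun _ h _ h' => ⟨h.1.inter h'.1, Set.union_subset h.2 h'.2⟩)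
    (fun _ h _ h' => ⟨h.1.inter h'.1, Set.union_subset h.2 h'.2⟩)
    ((List.range n).map F) (by simpa using fun k _ => hFS k)
    (fun Δ M d => M.IsModel T ∧ d ∈ M.ext C ∧ d ∈ M.ext C₀)
    (fun Δ M d => M.IsModel T ∧ d ∈ M.ext C ∧ d ∉ M.ext C₀) (by
      rintro ⟨D, hD, h1, h2⟩
      refine hexp ⟨D, hD.1, hD.2, fun Δ M hM d hd => ?_⟩
      by_cases hd₀ : d ∈ M.ext C₀
      · exact ⟨Or.inr (h1 Δ M d ⟨hM, hd, hd₀⟩), Or.inr hd₀⟩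
      · exact ⟨Or.inl hd₀, Or.inl (h2 Δ M d ⟨hM, hd, hd₀⟩)⟩)
  choose Δ Δ' M N d e hP hQ hag using hsep
  have hinl := fun n => isCover_inl (M n) (N n) L T
  have hinr := fun n => isCover_inr (M n) (N n) L T
  have hmod : (ultraproduct fun n => (M n).sum (N n)).IsModel T :=
    ultraproduct_isModel _ fun n => (hP n).1.sum hO hH hT (hQ n).1
  let x : Filter.Product (hyperfilter ℕ : Filter ℕ) fun n => Δ n ⊕ Δ' n :=
    Quotient.mk _ fun n => Sum.inl (d n)
  let y : Filter.Product (hyperfilter ℕ : Filter ℕ) fun n => Δ n ⊕ Δ' n :=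
    Quotient.mk _ fun n => Sum.inr (e n)
  have hx : ∀ {D}, T.IsConceptOf L D → (∀ᶠ n in hyperfilter ℕ, d n ∈ (M n).ext D) →
      x ∈ (ultraproduct fun n => (M n).sum (N n)).ext D := fun hD h =>
    mk_mem_ext_ultraproduct _ (h.mono fun n hn => ((hinl n).mem_ext_iff hO hD _).1 hn)
  have hy : ∀ {D}, T.IsConceptOf L D → (∀ᶠ n in hyperfilter ℕ, e n ∈ (N n).ext D) →
      y ∈ (ultraproduct fun n => (M n).sum (N n)).ext D := fun hD h =>
    mk_mem_ext_ultraproduct _ (h.mono fun n hn => ((hinr n).mem_ext_iff hO hD _).1 hn)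
  have hxy : (ultraproduct fun n => (M n).sum (N n)).equiv (conceptsOver L T Sg) x y := by
    intro D hD
    obtain ⟨k, rfl⟩ := hF ▸ hD
    have hev : ∀ᶠ n in hyperfilter ℕ, d n ∈ (M n).ext (F k) ↔ e n ∈ (N n).ext (F k) := by
      filter_upwards [Nat.hyperfilter_le_atTop (eventually_gt_atTop k)] with n hn
      exact hag n _ (List.mem_map_of_mem (List.mem_range.2 hn))
    by_cases h : ∀ᶠ n in hyperfilter ℕ, d n ∈ (M n).ext (F k)
    · refine iff_of_true (hx hD.1 h) (hy hD.1 ?_)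
      filter_upwards [h, hev] with n h1 h2 using h2.1 h1
    · rw [← Ultrafilter.eventually_not] at h
      refine iff_of_false (hx (D := .neg (F k)) hD.1 h) (hy (D := .neg (F k)) hD.1 ?_)
      filter_upwards [h, hev] with n h1 h2 using fun h3 => h1 (h2.2 h3)
  refine (hy (D := .neg C₀) hC₀ (.of_forall fun n => (hQ n).2.2)) ?_
  exact himp.mem_ext_of_equiv hO hH hT hC hC₀ hind hmod
    (fun R a b a' hR hRS hab ha => exists_equiv_successor _ hab hR hRS ha) hxy
    (hx hC (.of_forall fun n => (hP n).2.1)) (hy hC (.of_forall fun n => (hQ n).2.1))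
    (hx hC₀ (.of_forall fun n => (hP n).2.2))

end DescLogic

theorem mainTheorem4 :
    (∀ X : Set DescLogic.Feature,
      X ⊆ {DescLogic.Feature.S, DescLogic.Feature.I, DescLogic.Feature.F} →
        DescLogic.PBDP X) ∧
    (∀ X : Set DescLogic.Feature,
      X ⊆ {DescLogic.Feature.S, DescLogic.Feature.I, DescLogic.Feature.F} →
        ¬ DescLogic.PBDP (X ∪ {DescLogic.Feature.O}) ∧
        ¬ DescLogic.PBDP (X ∪ {DescLogic.Feature.H})) := by
  refine ⟨fun X hX => ?_, fun X _ => ⟨?_, ?_⟩⟩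
  · exact DescLogic.PBDP_of_no_nominals_no_roleHierarchies X (fun h => by simpa using hX h)
      (fun h => by simpa using hX h)
  · exact DescLogic.not_PBDP_of_nominals _ (Or.inr rfl)
  · exact DescLogic.not_PBDP_of_roleHierarchies _ (Or.inr rfl)
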